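/- Let $X$ be a discrete real-valued random variable, i.e. $\mathbb{P}(X\in A)=1$ for some finite or countably infinite set $A\subset\mathbb{R}$, whose Shannon entropy $H(X)=-\sum_{a\in A}\mathbb{P}(X=a)\log\mathbb{P}(X=a)$ is finite, and let $Z\sim\mathcal{N}(0,1)$ be independent of $X$. (Logarithms are natural.) For a random variable $Y$ with density $f$ on $\mathbb{R}$ let $h(Y)=-\int_{\mathbb{R}} f(x)\log f(x)\,dx\in[-\infty,\infty]$ denote its differential entropy, with $h(Y)=-\infty$ if $Y$ has no density or the integral does not exist, and let $I(Y)=\int_{\mathbb{R}} f'(x)^2/f(x)\,dx$ denote its Fisher information if $Y$ has a (locally) absolutely continuous density $f$, with $I(Y)=\infty$ otherwise. Then for every $t>0$ the quantities $h(X+\sqrt{t}\,Z)$ and $I(X+\sqrt{t}\,Z)$ are finite, the function $t\mapsto h(X+\sqrt{t}\,Z)$ is differentiable on $(0,\infty)$, and $$\frac{d}{dt}h(X+\sqrt{t}\,Z)=\frac12 I(X+\sqrt{t}\,Z),\qquad t>0.$$ -/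

import Mathlib

open MeasureTheory ProbabilityTheory Set
open scoped ENNReal

noncomputable section

namespace DeBruijn

/-- The discrete Shannon entropy (natural logarithm) `-∑ p(a) log p(a)`, `p(a) = μ {a}`, of a
probability measure `μ` on `ℝ`. All terms are nonnegative, so the sum is taken in `[0, ∞]`; points
of mass `0` contribute nothing, so for a `μ` carried by a countable set `A` this is the sum
over `A`. -/
def discreteEntropy (μ : Measure ℝ) : ℝ≥0∞ :=
  ∑' a : ℝ, ENNReal.ofReal (-(μ.real {a} * Real.log (μ.real {a})))

/-- The Lebesgue density of `μ` (meaningful when `μ ≪ volume`). -/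
def density (μ : Measure ℝ) (x : ℝ) : ℝ := (μ.rnDeriv volume x).toReal

/-- The integral of the positive part of `-f log f`, `f` the density of `μ`. -/
def entropyPos (μ : Measure ℝ) : ℝ≥0∞ :=
  ∫⁻ x, ENNReal.ofReal (-(density μ x * Real.log (density μ x)))

/-- The integral of the negative part of `-f log f`, `f` the density of `μ`. -/
def entropyNeg (μ : Measure ℝ) : ℝ≥0∞ :=
  ∫⁻ x, ENNReal.ofReal (density μ x * Real.log (density μ x))

open Classical in
/-- The differential entropy `h = -∫ f log f` of a probability measure on `ℝ` with density `f`,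
with values in `[-∞, ∞]`. It is `-∞` by convention if there is no density, or if the integral does
not exist (positive and negative parts both infinite). -/
def diffEntropy (μ : Measure ℝ) : EReal :=
  if μ ≪ volume ∧ ¬ (entropyPos μ = ∞ ∧ entropyNeg μ = ∞) then
    (entropyPos μ : EReal) - (entropyNeg μ : EReal)
  else ⊥

/-- `f` is an absolutely continuous (on every compact interval) probability density of `μ`. -/
structure IsACDensity (μ : Measure ℝ) (f : ℝ → ℝ) : Prop where
  nonneg : ∀ x, 0 ≤ f x
  absCont : ∀ a b : ℝ, AbsolutelyContinuousOnInterval f a b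
  eq_withDensity : μ = volume.withDensity (fun x => ENNReal.ofReal (f x))

/-- The Fisher information `∫ (f')² / f` of a measure with absolutely continuous density `f`,
and `∞` if there is no such density. The absolutely continuous density is unique if it exists
(see `fisherInfo_eq`), so that the infimum is over at most one function; the infimum over the
empty family is `∞`. Almost everywhere on `{f = 0}` one has `f' = 0`, and the integrand is `0`. -/
def fisherInfo (μ : Measure ℝ) : ℝ≥0∞ :=
  ⨅ (f : ℝ → ℝ) (_ : IsACDensity μ f), ∫⁻ x, ENNReal.ofReal ((deriv f x) ^ 2 / f x)

theorem IsACDensity.continuous {μ : Measure ℝ} {f : ℝ → ℝ} (hf : IsACDensity μ f) :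
    Continuous f := by
  rw [continuous_iff_continuousAt]
  intro x
  have h := (hf.absCont (x - 1) (x + 1)).continuousOn
  rw [uIcc_of_le (by linarith)] at h
  exact h.continuousAt (Icc_mem_nhds (by linarith) (by linarith))

theorem IsACDensity.unique {μ : Measure ℝ} {f g : ℝ → ℝ} (hf : IsACDensity μ f)
    (hg : IsACDensity μ g) : f = g := by
  have hfm : Measurable fun x => ENNReal.ofReal (f x) :=
    hf.continuous.measurable.ennreal_ofReal
  have hgm : Measurable fun x => ENNReal.ofReal (g x) :=
    hg.continuous.measurable.ennreal_ofReal
  have h : (fun x => ENNReal.ofReal (f x)) =ᵐ[volume] fun x => ENNReal.ofReal (g x) :=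
    (withDensity_eq_iff_of_sigmaFinite hfm.aemeasurable hgm.aemeasurable).1
      (hf.eq_withDensity.symm.trans hg.eq_withDensity)
  refine (hf.continuous.ae_eq_iff_eq volume hg.continuous).1 ?_
  filter_upwards [h] with x hx
  exact (ENNReal.ofReal_eq_ofReal_iff (hf.nonneg x) (hg.nonneg x)).1 hx

theorem fisherInfo_eq {μ : Measure ℝ} {f : ℝ → ℝ} (hf : IsACDensity μ f) :
    fisherInfo μ = ∫⁻ x, ENNReal.ofReal ((deriv f x) ^ 2 / f x) := by
  refine le_antisymm (iInf₂_le f hf) (le_iInf₂ fun g hg => ?_)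
  rw [hf.unique hg]

end DeBruijn

end

namespace DeBruijn

open Filter Topology

/-! Let `μ` be the law of `X` and `f_s` its average against the heat kernel of variance `s`, which
is the density of `X + √s Z`. It solves `∂_s f = f'' / 2`, so differentiating `-∫ f log f` under the
integral gives `-(1/2) ∫ f'' (1 + log f)`, and integration by parts turns this into `(1/2) ∫ f'² /
f`.

The difficulty is domination: `X` need not have moments, so `log f` has no a priori growth bound.
The atoms supply one. For each atom `a`, `f_s(x)` is at least `μ {a}` times the kernel at `x - a`,
hence `|log f_s(x)| ≤ (L a + C)(1 + (x - a)²)` with `L a = -log μ {a}`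
(`exists_abs_log_average_le`). As this holds for almost every `a` at once, the logarithm may be
moved inside the average over `a`, where the Gaussian absorbs the quadratic factor
(`abs_average_mul_le_envelope`). By Fubini the resulting envelope is integrable because `∫ L dμ =
H(X)` is finite (`integrable_envelope`). It serves all `s` in `(t/2, 2t)`, and it also removes the
boundary terms. Finiteness of the Fisher information comes from the pointwise bound `f'² / f ≤ f'' +
f / t`. -/

/-! ### The heat kernel -/

/-- The centred Gaussian density of variance `s`. -/
noncomputable def heatKernel (s y : ℝ) : ℝ :=
  (√(2 * Real.pi * s))⁻¹ * Real.exp (-y ^ 2 / (2 * s))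

/-- The first space derivative of the heat kernel. -/
noncomputable def heatKernelDeriv (s y : ℝ) : ℝ := -(y / s) * heatKernel s y

/-- The second space derivative of the heat kernel. -/
noncomputable def heatKernelDeriv₂ (s y : ℝ) : ℝ := (y ^ 2 / s ^ 2 - 1 / s) * heatKernel s y

theorem heatKernel_pos {s : ℝ} (hs : 0 < s) (y : ℝ) : 0 < heatKernel s y := by
  unfold heatKernel
  positivity

theorem continuous_heatKernel (s : ℝ) : Continuous (heatKernel s) := by
  unfold heatKernel
  fun_prop

theorem continuous_heatKernelDeriv (s : ℝ) : Continuous (heatKernelDeriv s) := by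
  have := continuous_heatKernel s
  unfold heatKernelDeriv
  fun_prop

theorem continuous_heatKernelDeriv₂ (s : ℝ) : Continuous (heatKernelDeriv₂ s) := by
  have := continuous_heatKernel s
  unfold heatKernelDeriv₂
  fun_prop

theorem hasDerivAt_heatKernel {s : ℝ} (hs : 0 < s) (y : ℝ) :
    HasDerivAt (heatKernel s) (heatKernelDeriv s y) y := by
  have h := ((((hasDerivAt_id y).pow 2).neg.div_const (2 * s)).exp).const_mul
    (√(2 * Real.pi * s))⁻¹
  refine h.congr_deriv ?_
  simp only [heatKernelDeriv, heatKernel, id, Pi.pow_apply, Pi.neg_apply]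
  field_simp
  norm_num

theorem hasDerivAt_heatKernelDeriv {s : ℝ} (hs : 0 < s) (y : ℝ) :
    HasDerivAt (heatKernelDeriv s) (heatKernelDeriv₂ s y) y := by
  have h := ((hasDerivAt_id y).div_const s).neg.mul (hasDerivAt_heatKernel hs y)
  refine h.congr_deriv ?_
  simp only [heatKernelDeriv, heatKernelDeriv₂, id, Pi.neg_apply]
  field_simp
  ring

/-- The heat equation for the heat kernel. -/
theorem hasDerivAt_heatKernel_time {s : ℝ} (hs : 0 < s) (y : ℝ) :
    HasDerivAt (fun r => heatKernel r y) (1 / 2 * heatKernelDeriv₂ s y) s := by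
  have hpi := Real.pi_pos
  have hq : 0 < 2 * Real.pi * s := by positivity
  have h1 := (((hasDerivAt_id s).const_mul (2 * Real.pi)).sqrt
    (by simpa using hq.ne')).inv (by simpa using (Real.sqrt_pos.2 hq).ne')
  have h2 := ((((hasDerivAt_id s).const_mul 2).inv (by simpa using hs.ne')).const_mul
    (-y ^ 2)).exp
  have h := h1.mul h2
  refine (h.congr_deriv ?_).congr_of_eventuallyEq ?_
  · have hsq : √(2 * Real.pi * s) ^ 2 = 2 * Real.pi * s := Real.sq_sqrt hq.le
    have hsp := Real.sqrt_pos.2 hq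
    simp only [heatKernelDeriv₂, heatKernel, id, Pi.inv_apply, div_eq_mul_inv (-y ^ 2)]
    rw [hsq]
    field_simp
    ring
  · filter_upwards with r
    simp [heatKernel, div_eq_mul_inv]

theorem heatKernel_le {s t : ℝ} (ht : 0 < t) (hs : s ∈ Ioo (t / 2) (2 * t)) (y : ℝ) :
    heatKernel s y ≤ (√(Real.pi * t))⁻¹ * Real.exp (-(y ^ 2 / (4 * t))) := by
  have hpi := Real.pi_pos
  obtain ⟨h1, h2⟩ := hs
  have hs0 : 0 < s := by linarith
  have h3 : Real.pi * t ≤ 2 * Real.pi * s := by nlinarith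
  have h4 : -y ^ 2 / (2 * s) ≤ -(y ^ 2 / (4 * t)) := by
    rw [neg_div, neg_le_neg_iff]
    exact div_le_div_of_nonneg_left (sq_nonneg y) (by positivity) (by linarith)
  unfold heatKernel
  have h5 : (√(2 * Real.pi * s))⁻¹ ≤ (√(Real.pi * t))⁻¹ := by gcongr
  gcongr

/-- This quadratic growth is the source of the weight `1 + y²` in the bounds below. -/
theorem neg_log_heatKernel_le {t : ℝ} (ht : 0 < t) :
    ∃ C : ℝ, 0 ≤ C ∧ ∀ s ∈ Ioo (t / 2) (2 * t), ∀ y : ℝ,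
      -Real.log (heatKernel s y) ≤ C * (1 + y ^ 2) := by
  have hpi := Real.pi_pos
  refine ⟨|Real.log √(2 * Real.pi * (2 * t))| + 1 / t, by positivity, fun s hs y => ?_⟩
  obtain ⟨h1, h2⟩ := hs
  have hs0 : 0 < s := by linarith
  have hq : 0 < 2 * Real.pi * s := by positivity
  have hl : Real.log √(2 * Real.pi * s) ≤ |Real.log √(2 * Real.pi * (2 * t))| := by
    refine le_trans (Real.log_le_log (Real.sqrt_pos.2 hq) ?_) (le_abs_self _)
    gcongr
  have hy : y ^ 2 / (2 * s) ≤ 1 / t * y ^ 2 := by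
    rw [one_div_mul_eq_div]
    gcongr
    linarith
  have he : -Real.log (heatKernel s y) = Real.log √(2 * Real.pi * s) + y ^ 2 / (2 * s) := by
    rw [heatKernel, Real.log_mul (by positivity) (Real.exp_pos _).ne', Real.log_exp,
      Real.log_inv]
    ring
  rw [he]
  have ha := abs_nonneg (Real.log √(2 * Real.pi * (2 * t)))
  have : 0 ≤ |Real.log √(2 * Real.pi * (2 * t))| * y ^ 2 := by positivity
  have : 0 ≤ 1 / t := by positivity
  nlinarith

theorem one_add_sq_mul_exp_le {b : ℝ} (hb : 0 < b) {u : ℝ} (hu : 0 ≤ u) :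
    (1 + u) ^ 2 * Real.exp (-(2 * b * u)) ≤ (2 + 4 / b ^ 2) * Real.exp (-(b * u)) := by
  have h := Real.quadratic_le_exp_of_nonneg (mul_nonneg hb.le hu)
  -- The term `4 / b²` is chosen so that `4 / b² * (b u)² / 2 = 2 u²`.
  have h1 : (1 + u) ^ 2 ≤ (2 + 4 / b ^ 2) * Real.exp (b * u) := by
    calc (1 + u) ^ 2 ≤ 2 + 2 * u ^ 2 := by nlinarith [sq_nonneg (1 - u)]
      _ ≤ (2 + 4 / b ^ 2) * (1 + b * u + (b * u) ^ 2 / 2) := by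
        have : (2 + 4 / b ^ 2) * (1 + b * u + (b * u) ^ 2 / 2) =
          (2 + 2 * u ^ 2) + (2 * (b * u) + (b * u) ^ 2 + 4 / b ^ 2 + 4 * u / b) := by
          field_simp
          ring
        rw [this]
        have : 0 ≤ 2 * (b * u) + (b * u) ^ 2 + 4 / b ^ 2 + 4 * u / b := by positivity
        linarith
      _ ≤ _ := by gcongr
  calc _ ≤ (2 + 4 / b ^ 2) * Real.exp (b * u) * Real.exp (-(2 * b * u)) := by gcongr
    _ = _ := by
      rw [mul_assoc, ← Real.exp_add]
      ring_nf

/-- The heat kernel and its derivatives, weighted by `1 + y²`, are dominated by one Gaussian,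
locally uniformly in time. -/
theorem exists_heatKernel_bound {t : ℝ} (ht : 0 < t) :
    ∃ K : ℝ, 0 ≤ K ∧ ∀ s ∈ Ioo (t / 2) (2 * t), ∀ y : ℝ,
      |heatKernel s y| * (1 + y ^ 2) ≤ K * Real.exp (-(1 / (8 * t)) * y ^ 2) ∧
      |heatKernelDeriv s y| * (1 + y ^ 2) ≤ K * Real.exp (-(1 / (8 * t)) * y ^ 2) ∧
      |heatKernelDeriv₂ s y| * (1 + y ^ 2) ≤ K * Real.exp (-(1 / (8 * t)) * y ^ 2) := by
  have hpi := Real.pi_pos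
  set A : ℝ := 1 + 2 / t + 4 / t ^ 2 with hA
  set B : ℝ := 2 + 4 / (1 / (8 * t)) ^ 2 with hB
  refine ⟨A * ((√(Real.pi * t))⁻¹ * B), by positivity, fun s hs y => ?_⟩
  have hs0 : 0 < s := by linarith [hs.1]
  have hst : 1 / s ≤ 2 / t := by
    rw [div_le_div_iff₀ hs0 ht]
    linarith [hs.1]
  have hst2 : 1 / s ^ 2 ≤ 4 / t ^ 2 := by
    have := pow_le_pow_left₀ (by positivity) hst 2
    simpa [div_pow, show (2 : ℝ) ^ 2 = 4 by norm_num] using this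
  have hpos := heatKernel_pos hs0 y
  -- All three kernels are a polynomial factor `q` times the heat kernel. `q` and the weight each
  -- cost one factor `1 + y²`, paid for by half of the Gaussian exponent `1 / (4t)`.
  have key : ∀ q : ℝ, |q| ≤ A * (1 + y ^ 2) →
      |q * heatKernel s y| * (1 + y ^ 2) ≤
        A * ((√(Real.pi * t))⁻¹ * B) * Real.exp (-(1 / (8 * t)) * y ^ 2) := by
    intro q hq
    rw [abs_mul, abs_of_pos hpos]
    have h1 := heatKernel_le ht hs y
    have h2 := one_add_sq_mul_exp_le (b := 1 / (8 * t)) (by positivity) (sq_nonneg y)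
    have h3 : Real.exp (-(y ^ 2 / (4 * t))) = Real.exp (-(2 * (1 / (8 * t)) * y ^ 2)) := by
      congr 1
      field_simp
      ring
    rw [h3] at h1
    calc |q| * heatKernel s y * (1 + y ^ 2)
        ≤ A * (1 + y ^ 2) * ((√(Real.pi * t))⁻¹ * Real.exp (-(2 * (1 / (8 * t)) * y ^ 2))) *
          (1 + y ^ 2) := by gcongr
      _ = A * (√(Real.pi * t))⁻¹ *
          ((1 + y ^ 2) ^ 2 * Real.exp (-(2 * (1 / (8 * t)) * y ^ 2))) := by ring
      _ ≤ A * (√(Real.pi * t))⁻¹ * (B * Real.exp (-(1 / (8 * t) * y ^ 2))) := by gcongr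
      _ = _ := by ring_nf
  have ht1 : 0 ≤ 2 / t := by positivity
  have ht2 : 0 ≤ 4 / t ^ 2 := by positivity
  have hs1 : 0 ≤ 1 / s := by positivity
  have hs2 : 0 ≤ 1 / s ^ 2 := by positivity
  refine ⟨?_, ?_, ?_⟩
  · have := key 1 (by rw [abs_one, hA]; nlinarith [sq_nonneg y])
    simpa using this
  · refine key _ ?_
    rw [abs_neg, abs_div, abs_of_pos hs0, div_eq_mul_one_div]
    have hy : |y| ≤ 1 + y ^ 2 := by nlinarith [sq_nonneg (|y| - 1), sq_abs y]
    calc |y| * (1 / s) ≤ (1 + y ^ 2) * (2 / t) := by gcongr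
      _ ≤ A * (1 + y ^ 2) := by rw [hA]; nlinarith [sq_nonneg y]
  · refine key _ ?_
    calc |y ^ 2 / s ^ 2 - 1 / s| ≤ |y ^ 2 / s ^ 2| + |1 / s| := abs_sub _ _
      _ = y ^ 2 * (1 / s ^ 2) + 1 / s := by
        rw [abs_of_nonneg (by positivity), abs_of_nonneg hs1, div_eq_mul_one_div]
      _ ≤ y ^ 2 * (4 / t ^ 2) + 2 / t := by gcongr
      _ ≤ A * (1 + y ^ 2) := by rw [hA]; nlinarith [sq_nonneg y, mul_nonneg ht1 (sq_nonneg y)]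

/-! ### Averages of translates of a kernel -/

/-- The convolution `x ↦ ∫ q (x - a) dμ(a)`. -/
noncomputable def average (μ : Measure ℝ) (q : ℝ → ℝ) (x : ℝ) : ℝ := ∫ a, q (x - a) ∂μ

section average

variable {μ : Measure ℝ} [IsProbabilityMeasure μ] {q q' : ℝ → ℝ} {K : ℝ}

theorem integrable_translate (hq : Continuous q) (hK : ∀ y, |q y| ≤ K) (x : ℝ) :
    Integrable (fun a => q (x - a)) μ :=
  Integrable.of_bound (by fun_prop) K (ae_of_all _ fun a => hK (x - a))

theorem continuous_average (hq : Continuous q) (hK : ∀ y, |q y| ≤ K) :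
    Continuous (average μ q) :=
  continuous_of_dominated (fun x => by fun_prop) (fun x => ae_of_all _ fun a => hK (x - a))
    (integrable_const K) (ae_of_all _ fun a => by fun_prop)

theorem hasDerivAt_average (hq : Continuous q) (hq' : Continuous q') (hK : ∀ y, |q y| ≤ K)
    (hK' : ∀ y, |q' y| ≤ K) (hd : ∀ y, HasDerivAt q (q' y) y) (x : ℝ) :
    HasDerivAt (average μ q) (average μ q' x) x :=
  (hasDerivAt_integral_of_dominated_loc_of_deriv_le (F := fun x a => q (x - a))
    (F' := fun x a => q' (x - a)) (bound := fun _ => K) univ_mem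
    (Eventually.of_forall fun x => by fun_prop) (integrable_translate hq hK x) (by fun_prop)
    (ae_of_all _ fun a x _ => hK' (x - a)) (integrable_const K)
    (ae_of_all _ fun a x _ => (hd (x - a)).comp_sub_const x a)).2

theorem abs_average_le (hK : ∀ y, |q y| ≤ K) (x : ℝ) : |average μ q x| ≤ K := by
  have := norm_integral_le_of_norm_le_const (μ := μ) (f := fun a => q (x - a)) (C := K)
    (ae_of_all _ fun a => hK (x - a))
  simpa [average] using this

/-- Discarding everything but one atom gives the lower bound that replaces moment assumptions. -/
theorem mass_mul_le_average (hq : Continuous q) (hq0 : ∀ y, 0 ≤ q y) (hK : ∀ y, |q y| ≤ K)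
    (x a : ℝ) : μ.real {a} * q (x - a) ≤ average μ q x := by
  have h := setIntegral_le_integral (s := {a}) (integrable_translate (μ := μ) hq hK x)
    (ae_of_all _ fun a => hq0 (x - a))
  simpa [average, integral_singleton, Measure.real] using h

end average

/-- The function `L` is integrable and bounds the negative logarithm of the mass of the atoms,
at almost every point. -/
structure IsLogMassBound (μ : Measure ℝ) (L : ℝ → ℝ) : Prop where
  measurable : Measurable L
  nonneg : ∀ a, 0 ≤ L a
  integrable : Integrable L μ
  exp_neg_le : ∀ᵐ a ∂μ, Real.exp (-L a) ≤ μ.real {a}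

/-- A common integrable bound for entropy-type integrands. -/
noncomputable def envelope (μ : Measure ℝ) (L : ℝ → ℝ) (c C K x : ℝ) : ℝ :=
  ∫ a, K * Real.exp (-c * (x - a) ^ 2) * (L a + C) ∂μ

section envelope

variable {μ : Measure ℝ} [IsProbabilityMeasure μ] {L : ℝ → ℝ} {c C K : ℝ}

theorem integrable_envelope_integrand (hL : IsLogMassBound μ L) (hc : 0 < c) (hK : 0 ≤ K)
    (x : ℝ) : Integrable (fun a => K * Real.exp (-c * (x - a) ^ 2) * (L a + C)) μ := by
  refine Integrable.bdd_mul (c := K) (hL.integrable.add (integrable_const C)) (by fun_prop)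
    (ae_of_all _ fun a => ?_)
  rw [Real.norm_of_nonneg (by positivity)]
  refine mul_le_of_le_one_right hK (Real.exp_le_one_iff.2 ?_)
  nlinarith [sq_nonneg (x - a)]

/-- Integrating in `x` first, the translated Gaussian contributes a constant independent of `a`, and
the integrability of `L` remains. -/
theorem integrable_envelope (hL : IsLogMassBound μ L) (hc : 0 < c) :
    Integrable (envelope μ L c C K) := by
  have hG : Integrable (fun y : ℝ => K * Real.exp (-c * y ^ 2)) :=
    (integrable_exp_neg_mul_sq hc).const_mul K
  have hm := hL.measurable
  have h : Integrable (fun p : ℝ × ℝ => K * Real.exp (-c * (p.1 - p.2) ^ 2) * (L p.2 + C))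
      ((volume : Measure ℝ).prod μ) := by
    rw [integrable_prod_iff' (by fun_prop)]
    refine ⟨ae_of_all _ fun a => (hG.comp_sub_right a).mul_const (L a + C), ?_⟩
    simp only [norm_mul, integral_mul_const]
    have : ∀ a : ℝ, ∫ x : ℝ, ‖K‖ * ‖Real.exp (-c * (x - a) ^ 2)‖ =
        ∫ x : ℝ, ‖K‖ * ‖Real.exp (-c * x ^ 2)‖ := fun a =>
      integral_sub_right_eq_self (fun x : ℝ => ‖K‖ * ‖Real.exp (-c * x ^ 2)‖) a
    simp only [this]
    exact (hL.integrable.add (integrable_const C)).norm.const_mul _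
  exact h.integral_prod_left

/-- Since `w` does not depend on `a`, it can be taken under the integral and bounded there by a
different quantity for each `a`. -/
theorem abs_average_mul_le_envelope (hL : IsLogMassBound μ L) (hc : 0 < c) (hK : 0 ≤ K)
    {q : ℝ → ℝ} (hqK : ∀ y, |q y| * (1 + y ^ 2) ≤ K * Real.exp (-c * y ^ 2)) {w x : ℝ}
    (hC : 0 ≤ C) (hw0 : 0 ≤ w) (hw : ∀ᵐ a ∂μ, w ≤ (L a + C) * (1 + (x - a) ^ 2)) :
    |average μ q x| * w ≤ envelope μ L c C K x := by
  calc |average μ q x| * w = ‖∫ a, q (x - a) * w ∂μ‖ := by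
        rw [integral_mul_const, norm_mul, Real.norm_of_nonneg hw0]
        rfl
    _ ≤ envelope μ L c C K x := by
        refine norm_integral_le_of_norm_le (integrable_envelope_integrand hL hc hK x) ?_
        filter_upwards [hw] with a ha
        have hLa := hL.nonneg a
        rw [norm_mul, Real.norm_of_nonneg hw0, Real.norm_eq_abs]
        calc |q (x - a)| * w ≤ |q (x - a)| * ((L a + C) * (1 + (x - a) ^ 2)) := by gcongr
          _ = |q (x - a)| * (1 + (x - a) ^ 2) * (L a + C) := by ring
          _ ≤ _ := by
            have := hqK (x - a)
            gcongr

end envelope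

/-! ### Smoothing by the heat kernel -/

section heat

variable {μ : Measure ℝ} [IsProbabilityMeasure μ] {L : ℝ → ℝ}

theorem le_of_weighted_le {q : ℝ → ℝ} {K c : ℝ} (hc : 0 ≤ c) (hK : 0 ≤ K)
    (h : ∀ y, |q y| * (1 + y ^ 2) ≤ K * Real.exp (-c * y ^ 2)) (y : ℝ) : |q y| ≤ K := by
  calc |q y| ≤ |q y| * (1 + y ^ 2) := le_mul_of_one_le_right (abs_nonneg _) (by nlinarith)
    _ ≤ K * Real.exp (-c * y ^ 2) := h y
    _ ≤ K := mul_le_of_le_one_right hK (Real.exp_le_one_iff.2 (by nlinarith [sq_nonneg y]))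

/-- Uniform bounds for the heat kernel and its derivatives, locally uniformly in time. -/
theorem exists_heatKernel_le {t : ℝ} (ht : 0 < t) :
    ∃ K : ℝ, 0 ≤ K ∧ ∀ s ∈ Ioo (t / 2) (2 * t), ∀ y : ℝ,
      |heatKernel s y| ≤ K ∧ |heatKernelDeriv s y| ≤ K ∧ |heatKernelDeriv₂ s y| ≤ K := by
  obtain ⟨K, hK, h⟩ := exists_heatKernel_bound ht
  have hc : 0 ≤ 1 / (8 * t) := by positivity
  exact ⟨K, hK, fun s hs y => ⟨le_of_weighted_le hc hK (fun y => (h s hs y).1) y,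
    le_of_weighted_le hc hK (fun y => (h s hs y).2.1) y,
    le_of_weighted_le hc hK (fun y => (h s hs y).2.2) y⟩⟩

theorem mem_Ioo_half_double {t : ℝ} (ht : 0 < t) : t ∈ Ioo (t / 2) (2 * t) :=
  ⟨by linarith, by linarith⟩

theorem pos_of_mem_Ioo_half_double {s t : ℝ} (ht : 0 < t) (hs : s ∈ Ioo (t / 2) (2 * t)) :
    0 < s := by linarith [hs.1]

variable (μ) in
theorem continuous_average_heatKernel {t : ℝ} (ht : 0 < t) :
    Continuous (average μ (heatKernel t)) := by
  obtain ⟨K, -, h⟩ := exists_heatKernel_le ht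
  exact continuous_average (continuous_heatKernel t) fun y => (h t (mem_Ioo_half_double ht) y).1

variable (μ) in
theorem continuous_average_heatKernelDeriv {t : ℝ} (ht : 0 < t) :
    Continuous (average μ (heatKernelDeriv t)) := by
  obtain ⟨K, -, h⟩ := exists_heatKernel_le ht
  exact continuous_average (continuous_heatKernelDeriv t)
    fun y => (h t (mem_Ioo_half_double ht) y).2.1

variable (μ) in
theorem continuous_average_heatKernelDeriv₂ {t : ℝ} (ht : 0 < t) :
    Continuous (average μ (heatKernelDeriv₂ t)) := by
  obtain ⟨K, -, h⟩ := exists_heatKernel_le ht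
  exact continuous_average (continuous_heatKernelDeriv₂ t)
    fun y => (h t (mem_Ioo_half_double ht) y).2.2

variable (μ) in
theorem hasDerivAt_average_heatKernel {t : ℝ} (ht : 0 < t) (x : ℝ) :
    HasDerivAt (average μ (heatKernel t)) (average μ (heatKernelDeriv t) x) x := by
  obtain ⟨K, -, h⟩ := exists_heatKernel_le ht
  have h' := h t (mem_Ioo_half_double ht)
  exact hasDerivAt_average (continuous_heatKernel t) (continuous_heatKernelDeriv t)
    (fun y => (h' y).1) (fun y => (h' y).2.1) (hasDerivAt_heatKernel ht) x

variable (μ) in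
theorem hasDerivAt_average_heatKernelDeriv {t : ℝ} (ht : 0 < t) (x : ℝ) :
    HasDerivAt (average μ (heatKernelDeriv t)) (average μ (heatKernelDeriv₂ t) x) x := by
  obtain ⟨K, -, h⟩ := exists_heatKernel_le ht
  have h' := h t (mem_Ioo_half_double ht)
  exact hasDerivAt_average (continuous_heatKernelDeriv t) (continuous_heatKernelDeriv₂ t)
    (fun y => (h' y).2.1) (fun y => (h' y).2.2) (hasDerivAt_heatKernelDeriv ht) x

variable (μ) in
/-- The heat equation for the smoothed density. -/
theorem hasDerivAt_average_heatKernel_time {t : ℝ} (ht : 0 < t) (x : ℝ) :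
    HasDerivAt (fun s => average μ (heatKernel s) x)
      (1 / 2 * average μ (heatKernelDeriv₂ t) x) t := by
  obtain ⟨K, -, h⟩ := exists_heatKernel_le ht
  have htt := mem_Ioo_half_double ht
  have hI := Ioo_mem_nhds htt.1 htt.2
  have hc := fun s => continuous_heatKernel s
  have hc₂ := fun s => continuous_heatKernelDeriv₂ s
  have key := (hasDerivAt_integral_of_dominated_loc_of_deriv_le (μ := μ)
    (F := fun s a => heatKernel s (x - a))
    (F' := fun s a => 1 / 2 * heatKernelDeriv₂ s (x - a)) (bound := fun _ => K) hI
    (Eventually.of_forall fun s => ((hc s).comp (by fun_prop)).aestronglyMeasurable)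
    (integrable_translate (hc t) (fun y => (h t htt y).1) x)
    ((((hc₂ t).comp (by fun_prop : Continuous fun a : ℝ => x - a)).const_mul
      _).aestronglyMeasurable)
    (ae_of_all _ fun a s hs => ?_) (integrable_const K)
    (ae_of_all _ fun a s hs => hasDerivAt_heatKernel_time
      (pos_of_mem_Ioo_half_double ht hs) (x - a))).2
  · simpa only [integral_const_mul, average] using key
  · have := (h s hs (x - a)).2.2
    rw [norm_mul, Real.norm_eq_abs (heatKernelDeriv₂ _ _)]
    norm_num
    linarith [abs_nonneg (heatKernelDeriv₂ s (x - a))]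

theorem exp_neg_mul_le_average (hL : IsLogMassBound μ L) {t : ℝ} (ht : 0 < t) (x : ℝ) :
    ∀ᵐ a ∂μ, Real.exp (-L a) * heatKernel t (x - a) ≤ average μ (heatKernel t) x := by
  obtain ⟨K, -, h⟩ := exists_heatKernel_le ht
  filter_upwards [hL.exp_neg_le] with a ha
  have h1 := mass_mul_le_average (μ := μ) (continuous_heatKernel t)
    (fun y => (heatKernel_pos ht y).le) (fun y => (h t (mem_Ioo_half_double ht) y).1) x a
  have := (heatKernel_pos ht (x - a)).le
  refine le_trans ?_ h1
  gcongr

theorem average_heatKernel_pos (hL : IsLogMassBound μ L) {t : ℝ} (ht : 0 < t) (x : ℝ) :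
    0 < average μ (heatKernel t) x := by
  obtain ⟨a, ha⟩ := (exp_neg_mul_le_average hL ht x).exists
  exact lt_of_lt_of_le (mul_pos (Real.exp_pos _) (heatKernel_pos ht _)) ha

/-- From above `log f ≤ f ≤ K`; from below a single atom suffices. The summand `1` anticipates the
factor `1 + log f` in the derivative of `f log f`. -/
theorem exists_abs_log_average_le (hL : IsLogMassBound μ L) {t : ℝ} (ht : 0 < t) :
    ∃ C : ℝ, 0 ≤ C ∧ ∀ s ∈ Ioo (t / 2) (2 * t), ∀ x : ℝ, ∀ᵐ a ∂μ,
      1 + |Real.log (average μ (heatKernel s) x)| ≤ (L a + C) * (1 + (x - a) ^ 2) := by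
  obtain ⟨K, hK, h⟩ := exists_heatKernel_le ht
  obtain ⟨C, hC, hlog⟩ := neg_log_heatKernel_le ht
  refine ⟨1 + K + C, by positivity, fun s hs x => ?_⟩
  have hs0 := pos_of_mem_Ioo_half_double ht hs
  filter_upwards [exp_neg_mul_le_average hL hs0 x] with a ha
  have hpos := average_heatKernel_pos hL hs0 x
  have hk := heatKernel_pos hs0 (x - a)
  have hup : Real.log (average μ (heatKernel s) x) ≤ K :=
    (Real.log_le_self hpos.le).trans ((le_abs_self _).trans
      (abs_average_le (fun y => (h s hs y).1) x))
  have hlow : -Real.log (average μ (heatKernel s) x) ≤ L a + C * (1 + (x - a) ^ 2) := by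
    have h1 := Real.log_le_log (mul_pos (Real.exp_pos _) hk) ha
    rw [Real.log_mul (Real.exp_pos _).ne' hk.ne', Real.log_exp] at h1
    linarith [hlog s hs (x - a)]
  have hLa := hL.nonneg a
  have hx := sq_nonneg (x - a)
  have : |Real.log (average μ (heatKernel s) x)| ≤ L a + K + C * (1 + (x - a) ^ 2) :=
    abs_le.2 ⟨by linarith, by nlinarith [mul_nonneg hC hx]⟩
  nlinarith [mul_nonneg hLa hx, mul_nonneg hK hx]

end heat

/-! ### The entropy of the smoothed density -/

section entropy

variable {μ : Measure ℝ} [IsProbabilityMeasure μ] {L : ℝ → ℝ}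

theorem exists_integrable_bound (hL : IsLogMassBound μ L) {t : ℝ} (ht : 0 < t) :
    ∃ D : ℝ → ℝ, Integrable D ∧ ∀ s ∈ Ioo (t / 2) (2 * t), ∀ x : ℝ,
      |average μ (heatKernel s) x| * (1 + |Real.log (average μ (heatKernel s) x)|) ≤ D x ∧
      |average μ (heatKernelDeriv s) x| * (1 + |Real.log (average μ (heatKernel s) x)|) ≤ D x ∧
      |average μ (heatKernelDeriv₂ s) x| * (1 + |Real.log (average μ (heatKernel s) x)|)
        ≤ D x := by
  obtain ⟨K, hK, h⟩ := exists_heatKernel_bound ht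
  obtain ⟨C, hC, hw⟩ := exists_abs_log_average_le hL ht
  have hc : 0 < 1 / (8 * t) := by positivity
  refine ⟨_, integrable_envelope (C := C) (K := K) hL hc, fun s hs x => ⟨?_, ?_, ?_⟩⟩ <;>
    refine abs_average_mul_le_envelope hL hc hK ?_ hC (by positivity) (hw s hs x)
  exacts [fun y => (h s hs y).1, fun y => (h s hs y).2.1, fun y => (h s hs y).2.2]

theorem continuous_log_average_heatKernel (hL : IsLogMassBound μ L) {t : ℝ} (ht : 0 < t) :
    Continuous fun x => Real.log (average μ (heatKernel t) x) :=
  (continuous_average_heatKernel μ ht).log fun x => (average_heatKernel_pos hL ht x).ne'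

theorem integrable_average_heatKernel_mul_log (hL : IsLogMassBound μ L) {t : ℝ} (ht : 0 < t) :
    Integrable fun x => average μ (heatKernel t) x * Real.log (average μ (heatKernel t) x) := by
  obtain ⟨D, hD, h⟩ := exists_integrable_bound hL ht
  refine hD.mono' ((continuous_average_heatKernel μ ht).mul
    (continuous_log_average_heatKernel hL ht)).aestronglyMeasurable (ae_of_all _ fun x => ?_)
  rw [norm_mul, Real.norm_eq_abs, Real.norm_eq_abs]
  refine le_trans ?_ (h t (mem_Ioo_half_double ht) x).1
  gcongr
  linarith

theorem integrable_average_heatKernel (hL : IsLogMassBound μ L) {t : ℝ} (ht : 0 < t) :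
    Integrable (average μ (heatKernel t)) := by
  obtain ⟨D, hD, h⟩ := exists_integrable_bound hL ht
  refine hD.mono' (continuous_average_heatKernel μ ht).aestronglyMeasurable
    (ae_of_all _ fun x => ?_)
  exact (le_mul_of_one_le_right (abs_nonneg _) (by simp)).trans
    (h t (mem_Ioo_half_double ht) x).1

theorem integrable_average_heatKernelDeriv₂ (hL : IsLogMassBound μ L) {t : ℝ} (ht : 0 < t) :
    Integrable (average μ (heatKernelDeriv₂ t)) := by
  obtain ⟨D, hD, h⟩ := exists_integrable_bound hL ht
  refine hD.mono' (continuous_average_heatKernelDeriv₂ μ ht).aestronglyMeasurable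
    (ae_of_all _ fun x => ?_)
  exact (le_mul_of_one_le_right (abs_nonneg _) (by simp)).trans
    (h t (mem_Ioo_half_double ht) x).2.2

theorem abs_mul_one_add_log_le (u v : ℝ) : |u * (1 + v)| ≤ |u| * (1 + |v|) := by
  rw [abs_mul]
  gcongr
  simpa using abs_add_le 1 v

theorem integrable_average_heatKernelDeriv_mul (hL : IsLogMassBound μ L) {t : ℝ} (ht : 0 < t) :
    Integrable fun x => average μ (heatKernelDeriv t) x *
      (1 + Real.log (average μ (heatKernel t) x)) := by
  obtain ⟨D, hD, h⟩ := exists_integrable_bound hL ht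
  exact hD.mono' ((continuous_average_heatKernelDeriv μ ht).mul
    ((continuous_log_average_heatKernel hL ht).const_add 1)).aestronglyMeasurable
    (ae_of_all _ fun x => (abs_mul_one_add_log_le _ _).trans
      (h t (mem_Ioo_half_double ht) x).2.1)

theorem integrable_average_heatKernelDeriv₂_mul (hL : IsLogMassBound μ L) {t : ℝ}
    (ht : 0 < t) :
    Integrable fun x => average μ (heatKernelDeriv₂ t) x *
      (1 + Real.log (average μ (heatKernel t) x)) := by
  obtain ⟨D, hD, h⟩ := exists_integrable_bound hL ht
  exact hD.mono' ((continuous_average_heatKernelDeriv₂ μ ht).mul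
    ((continuous_log_average_heatKernel hL ht).const_add 1)).aestronglyMeasurable
    (ae_of_all _ fun x => (abs_mul_one_add_log_le _ _).trans
      (h t (mem_Ioo_half_double ht) x).2.2)

/-- The Cauchy–Schwarz inequality behind the finiteness of the Fisher information. -/
theorem sq_average_heatKernelDeriv_div_le (hL : IsLogMassBound μ L) {t : ℝ} (ht : 0 < t)
    (x : ℝ) :
    average μ (heatKernelDeriv t) x ^ 2 / average μ (heatKernel t) x ≤
      average μ (heatKernelDeriv₂ t) x + 1 / t * average μ (heatKernel t) x := by
  obtain ⟨K, -, h⟩ := exists_heatKernel_le ht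
  have h' := h t (mem_Ioo_half_double ht)
  have hpos := average_heatKernel_pos hL ht x
  set r : ℝ := average μ (heatKernelDeriv t) x / average μ (heatKernel t) x with hr
  have i0 := integrable_translate (μ := μ) (continuous_heatKernel t) (fun y => (h' y).1) x
  have i1 := integrable_translate (μ := μ) (continuous_heatKernelDeriv t)
    (fun y => (h' y).2.1) x
  have i2 := integrable_translate (μ := μ) (continuous_heatKernelDeriv₂ t)
    (fun y => (h' y).2.2) x
  -- Under the weights `heatKernel t (x - a)` the mean of `(x - a) / t` is `-r`, so this is an
  -- unnormalised variance.
  have hnn : 0 ≤ ∫ a, heatKernel t (x - a) * ((x - a) / t + r) ^ 2 ∂μ :=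
    integral_nonneg fun a => mul_nonneg (heatKernel_pos ht _).le (sq_nonneg _)
  have heq : ∀ a : ℝ, heatKernel t (x - a) * ((x - a) / t + r) ^ 2 =
      heatKernelDeriv₂ t (x - a) + (-2 * r) * heatKernelDeriv t (x - a) +
        (1 / t + r ^ 2) * heatKernel t (x - a) := fun a => by
    simp only [heatKernelDeriv, heatKernelDeriv₂]
    ring
  simp only [heq] at hnn
  have i12 : Integrable (fun a => heatKernelDeriv₂ t (x - a) +
      -2 * r * heatKernelDeriv t (x - a)) μ := i2.add (i1.const_mul _)
  rw [integral_add i12 (i0.const_mul _), integral_add i2 (i1.const_mul _), integral_const_mul, integral_const_mul] at hnn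
  change 0 ≤ average μ (heatKernelDeriv₂ t) x + -2 * r * average μ (heatKernelDeriv t) x +
    (1 / t + r ^ 2) * average μ (heatKernel t) x at hnn
  have h1 : r * average μ (heatKernelDeriv t) x =
      average μ (heatKernelDeriv t) x ^ 2 / average μ (heatKernel t) x := by
    rw [hr]
    ring
  have h2 : r ^ 2 * average μ (heatKernel t) x =
      average μ (heatKernelDeriv t) x ^ 2 / average μ (heatKernel t) x := by
    rw [hr]
    field_simp
  linarith

theorem integrable_sq_average_heatKernelDeriv_div (hL : IsLogMassBound μ L) {t : ℝ}
    (ht : 0 < t) :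
    Integrable fun x =>
      average μ (heatKernelDeriv t) x ^ 2 / average μ (heatKernel t) x := by
  refine ((integrable_average_heatKernelDeriv₂ hL ht).add
    ((integrable_average_heatKernel hL ht).const_mul (1 / t))).mono'
    (((continuous_average_heatKernelDeriv μ ht).pow 2).div (continuous_average_heatKernel μ ht)
      fun x => (average_heatKernel_pos hL ht x).ne').aestronglyMeasurable
    (ae_of_all _ fun x => ?_)
  rw [Real.norm_of_nonneg (div_nonneg (sq_nonneg _) (average_heatKernel_pos hL ht x).le)]
  exact sq_average_heatKernelDeriv_div_le hL ht x

/-- Integration by parts, without boundary terms. -/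
theorem integral_average_heatKernelDeriv₂_mul (hL : IsLogMassBound μ L) {t : ℝ} (ht : 0 < t) :
    ∫ x, average μ (heatKernelDeriv₂ t) x * (1 + Real.log (average μ (heatKernel t) x)) =
      -∫ x, average μ (heatKernelDeriv t) x ^ 2 / average μ (heatKernel t) x := by
  have i1 := integrable_average_heatKernelDeriv₂_mul hL ht
  have i2 := integrable_sq_average_heatKernelDeriv_div hL ht
  -- Both `f' (1 + log f)` and its derivative are integrable on the line, so the derivative has
  -- integral zero.
  have h := integral_eq_zero_of_hasDerivAt_of_integrable (fun x => ?_) (i1.add i2)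
    (integrable_average_heatKernelDeriv_mul hL ht)
  · rw [integral_add' i1 i2] at h
    linarith
  · have hd := (hasDerivAt_average_heatKernelDeriv μ ht x).mul
      (((hasDerivAt_average_heatKernel μ ht x).log
        (average_heatKernel_pos hL ht x).ne').const_add 1)
    refine hd.congr_deriv ?_
    simp only [Pi.add_apply]
    ring

/-- De Bruijn's identity for the smoothed densities. -/
theorem hasDerivAt_integral_neg_mul_log (hL : IsLogMassBound μ L) {t : ℝ} (ht : 0 < t) :
    HasDerivAt (fun s => ∫ x, -(average μ (heatKernel s) x *
        Real.log (average μ (heatKernel s) x)))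
      (1 / 2 * ∫ x, average μ (heatKernelDeriv t) x ^ 2 / average μ (heatKernel t) x) t := by
  obtain ⟨D, hD, h⟩ := exists_integrable_bound hL ht
  have htt := mem_Ioo_half_double ht
  have hI := Ioo_mem_nhds htt.1 htt.2
  have key := (hasDerivAt_integral_of_dominated_loc_of_deriv_le (μ := volume)
    (F := fun s x => -(average μ (heatKernel s) x * Real.log (average μ (heatKernel s) x)))
    (F' := fun s x => -(1 / 2) * (average μ (heatKernelDeriv₂ s) x *
      (1 + Real.log (average μ (heatKernel s) x)))) (bound := D) hI
    ?_ (integrable_average_heatKernel_mul_log hL ht).neg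
    ((integrable_average_heatKernelDeriv₂_mul hL ht).const_mul _).aestronglyMeasurable
    (ae_of_all _ fun x s hs => ?_) hD (ae_of_all _ fun x s hs => ?_)).2
  · rw [integral_const_mul, integral_average_heatKernelDeriv₂_mul hL ht] at key
    simpa only [neg_mul_neg] using key
  · filter_upwards [hI] with s hs
    have hs0 := pos_of_mem_Ioo_half_double ht hs
    exact (integrable_average_heatKernel_mul_log hL hs0).neg.aestronglyMeasurable
  · have h1 := (abs_mul_one_add_log_le _ _).trans (h s hs x).2.2
    rw [norm_mul, Real.norm_eq_abs (_ * (1 + _)), norm_neg,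
      Real.norm_of_nonneg (by norm_num)]
    linarith [abs_nonneg (average μ (heatKernelDeriv₂ s) x *
      (1 + Real.log (average μ (heatKernel s) x)))]
  · have hs0 := pos_of_mem_Ioo_half_double ht hs
    have hp := (average_heatKernel_pos hL hs0 x).ne'
    have hd := hasDerivAt_average_heatKernel_time μ hs0 x
    refine (hd.mul (hd.log hp)).neg.congr_deriv ?_
    field_simp
    ring

end entropy

/-! ### Laws, entropies and Fisher information -/

theorem heatKernel_eq_gaussianPDFReal {t : ℝ} (ht : 0 < t) (x a : ℝ) :
    heatKernel t (x - a) = gaussianPDFReal a (Real.toNNReal t) x := by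
  simp [heatKernel, gaussianPDFReal, Real.coe_toNNReal t ht.le]

theorem map_add_sqrt_mul_eq_withDensity {Ω : Type*} [MeasurableSpace Ω] {P : Measure Ω}
    [IsProbabilityMeasure P] {X Z : Ω → ℝ} (hX : AEMeasurable X P)
    (hZ : HasLaw Z (gaussianReal 0 1) P) (hXZ : IndepFun X Z P) {t : ℝ} (ht : 0 < t) :
    P.map (fun ω => X ω + √t * Z ω) = volume.withDensity fun x =>
      ENNReal.ofReal (average (P.map X) (heatKernel t) x) := by
  have : IsProbabilityMeasure (P.map X) := Measure.isProbabilityMeasure_map hX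
  have htn : Real.toNNReal t ≠ 0 := by simpa using ht
  have hlaw := gaussianReal_const_mul hZ √t
  have hmap : P.map (fun ω => √t * Z ω) = gaussianReal 0 (Real.toNNReal t) := by
    rw [hlaw.map_eq]
    congr 1
    · simp
    · ext
      simp [Real.sq_sqrt ht.le, ht.le]
  have hind : IndepFun X (fun ω => √t * Z ω) P :=
    hXZ.comp measurable_id (measurable_const_mul √t)
  have hconv := hind.map_add_eq_map_conv_map₀ hX hlaw.aemeasurable
  change P.map (fun ω => X ω + √t * Z ω) = _ at hconv
  rw [hconv, hmap]
  obtain ⟨K, -, hK⟩ := exists_heatKernel_le ht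
  ext B hB
  have hc := continuous_heatKernel t
  have hof : ∀ x, ENNReal.ofReal (average (P.map X) (heatKernel t) x) =
      ∫⁻ a, ENNReal.ofReal (heatKernel t (x - a)) ∂(P.map X) := fun x =>
    ofReal_integral_eq_lintegral_ofReal
      (integrable_translate hc (fun y => (hK t (mem_Ioo_half_double ht) y).1) x)
      (ae_of_all _ fun a => (heatKernel_pos ht _).le)
  rw [withDensity_apply _ hB]
  simp only [hof]
  -- After Tonelli both sides are `μ`-integrals over `a` of the mass of `B` under the Gaussian
  -- centred at `a`.
  rw [lintegral_lintegral_swap (by fun_prop), ← lintegral_indicator_one hB,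
    Measure.lintegral_conv (by fun_prop (disch := exact hB))]
  refine lintegral_congr fun a => ?_
  have h1 : ∫⁻ y, B.indicator 1 (a + y) ∂(gaussianReal 0 (Real.toNNReal t)) =
      ((gaussianReal 0 (Real.toNNReal t)).map (a + ·)) B := by
    rw [← lintegral_indicator_one hB, lintegral_map (measurable_one.indicator hB) (by fun_prop)]
  rw [h1, gaussianReal_map_const_add, zero_add, gaussianReal_apply _ htn]
  simp only [heatKernel_eq_gaussianPDFReal ht, gaussianPDF]

section density

variable {ν : Measure ℝ} {f : ℝ → ℝ}

theorem density_ae_eq (hf : Measurable f) (hf0 : ∀ x, 0 ≤ f x)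
    (hν : ν = volume.withDensity fun x => ENNReal.ofReal (f x)) : density ν =ᵐ[volume] f := by
  filter_upwards [Measure.rnDeriv_withDensity volume hf.ennreal_ofReal] with x hx
  rw [density, hν, hx, ENNReal.toReal_ofReal (hf0 x)]

/-- If `f log f` is integrable, the differential entropy is the Bochner integral. -/
theorem diffEntropy_eq (hf : Measurable f) (hf0 : ∀ x, 0 ≤ f x)
    (hν : ν = volume.withDensity fun x => ENNReal.ofReal (f x))
    (hint : Integrable fun x => f x * Real.log (f x)) :
    diffEntropy ν = ((∫ x, -(f x * Real.log (f x)) : ℝ) : EReal) := by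
  have hd := density_ae_eq hf hf0 hν
  have hp : entropyPos ν = ∫⁻ x, ENNReal.ofReal (-(f x * Real.log (f x))) :=
    lintegral_congr_ae (by filter_upwards [hd] with x hx; rw [hx])
  have hn : entropyNeg ν = ∫⁻ x, ENNReal.ofReal (f x * Real.log (f x)) :=
    lintegral_congr_ae (by filter_upwards [hd] with x hx; rw [hx])
  have hpt : entropyPos ν ≠ ∞ := by
    rw [hp]
    exact hint.neg.lintegral_lt_top.ne
  have hnt : entropyNeg ν ≠ ∞ := by
    rw [hn]
    exact hint.lintegral_lt_top.ne
  have hac : ν ≪ volume := hν ▸ withDensity_absolutelyContinuous _ _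
  have hint' : Integrable fun x => -(f x * Real.log (f x)) := hint.neg
  rw [diffEntropy, if_pos ⟨hac, fun h => hpt h.1⟩,
    integral_eq_lintegral_pos_part_sub_lintegral_neg_part hint']
  simp only [neg_neg]
  rw [← hp, ← hn, EReal.coe_sub, EReal.coe_ennreal_toReal hpt, EReal.coe_ennreal_toReal hnt]

theorem isACDensity_of_contDiff (hf : ContDiff ℝ 1 f) (hf0 : ∀ x, 0 ≤ f x)
    (hν : ν = volume.withDensity fun x => ENNReal.ofReal (f x)) : IsACDensity ν f :=
  ⟨hf0, fun _ _ => hf.contDiffOn.absolutelyContinuousOnInterval, hν⟩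

end density

/-- The integral of `-log μ {a}` against `μ` is the Shannon entropy. -/
theorem isLogMassBound_neg_log {μ : Measure ℝ} [IsProbabilityMeasure μ] {A : Set ℝ}
    (hA : A.Countable) (hμA : ∀ᵐ a ∂μ, a ∈ A) (hH : discreteEntropy μ ≠ ∞) :
    IsLogMassBound μ fun a => -Real.log (μ.real {a}) := by
  have hnn : ∀ a, 0 ≤ -Real.log (μ.real {a}) := fun a =>
    neg_nonneg.2 (Real.log_nonpos measureReal_nonneg measureReal_le_one)
  have hz : ∀ a ∉ A, μ.real {a} = 0 := fun a ha => by
    rw [measureReal_def, measure_mono_null (singleton_subset_iff.2 ha) hμA, ENNReal.toReal_zero]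
  have hmeas : Measurable fun a => -Real.log (μ.real {a}) := by
    -- As `Real.log 0 = 0`, the function vanishes off the countable set `A`.
    refine (measurable_zero (α := ℝ) (β := ℝ)).measurable_of_countable_ne (hA.mono fun a ha => ?_)
    by_contra h
    exact ha (by simp [hz a h])
  refine ⟨hmeas, hnn, ⟨hmeas.aestronglyMeasurable, ?_⟩, ?_⟩
  · rw [hasFiniteIntegral_iff_ofReal (ae_of_all _ hnn),
      ← Measure.restrict_eq_self_of_ae_mem hμA, lintegral_countable _ hA]
    rw [Measure.restrict_eq_self_of_ae_mem hμA]
    refine lt_of_le_of_lt ?_ (lt_top_iff_ne_top.2 hH)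
    refine le_trans (ENNReal.tsum_le_tsum fun a => ?_)
      (ENNReal.tsum_comp_le_tsum_of_injective (f := ((↑) : A → ℝ)) Subtype.val_injective _)
    rw [← ENNReal.ofReal_toReal (measure_ne_top μ {(a : ℝ)}), ← ENNReal.ofReal_mul (hnn a),
      ← measureReal_def]
    exact (congrArg ENNReal.ofReal (by ring)).le
  -- At massless points the convention `Real.log 0 = 0` makes the bound read `1 ≤ 0`; those in `A`
  -- are negligible by countability.
  · have hnull : μ {a ∈ A | μ {a} = 0} = 0 := by
      rw [← biUnion_of_singleton {a ∈ A | μ {a} = 0},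
        measure_biUnion_null_iff (hA.mono (sep_subset _ _))]
      exact fun a ha => ha.2
    filter_upwards [hμA, measure_eq_zero_iff_ae_notMem.1 hnull] with a ha ha'
    have : 0 < μ.real {a} :=
      ENNReal.toReal_pos (fun h => ha' ⟨ha, h⟩) (measure_ne_top _ _)
    rw [neg_neg, Real.exp_log this]

end DeBruijn

theorem corollary1 {Ω : Type*} [MeasurableSpace Ω] (P : Measure Ω) [IsProbabilityMeasure P]
    (X Z : Ω → ℝ) (hX : AEMeasurable X P)
    (hXdiscrete : ∃ A : Set ℝ, A.Countable ∧ ∀ᵐ ω ∂P, X ω ∈ A)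
    (hXentropy : DeBruijn.discreteEntropy (P.map X) ≠ ∞)
    (hZ : HasLaw Z (gaussianReal 0 1) P)
    (hXZ : IndepFun X Z P) :
    ∀ t : ℝ, 0 < t →
      DeBruijn.diffEntropy (P.map (fun ω => X ω + Real.sqrt t * Z ω)) ≠ ⊥ ∧
      DeBruijn.diffEntropy (P.map (fun ω => X ω + Real.sqrt t * Z ω)) ≠ ⊤ ∧
      DeBruijn.fisherInfo (P.map (fun ω => X ω + Real.sqrt t * Z ω)) ≠ ∞ ∧
      HasDerivAt
        (fun s : ℝ => (DeBruijn.diffEntropy (P.map (fun ω => X ω + Real.sqrt s * Z ω))).toReal)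
        (1 / 2 * (DeBruijn.fisherInfo (P.map (fun ω => X ω + Real.sqrt t * Z ω))).toReal) t := by
  intro t ht
  obtain ⟨A, hA, hXA⟩ := hXdiscrete
  have hμ : IsProbabilityMeasure (P.map X) := Measure.isProbabilityMeasure_map hX
  have hL := DeBruijn.isLogMassBound_neg_log hA
    ((ae_map_iff hX hA.measurableSet).2 hXA) hXentropy
  have hlaw := fun {s : ℝ} (hs : 0 < s) =>
    DeBruijn.map_add_sqrt_mul_eq_withDensity hX hZ hXZ hs
  have hent := fun {s : ℝ} (hs : 0 < s) =>
    DeBruijn.diffEntropy_eq (DeBruijn.continuous_average_heatKernel (P.map X) hs).measurable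
      (fun x => (DeBruijn.average_heatKernel_pos hL hs x).le) (hlaw hs)
      (DeBruijn.integrable_average_heatKernel_mul_log hL hs)
  have hderiv : deriv (DeBruijn.average (P.map X) (DeBruijn.heatKernel t)) =
      DeBruijn.average (P.map X) (DeBruijn.heatKernelDeriv t) :=
    funext fun x => (DeBruijn.hasDerivAt_average_heatKernel (P.map X) ht x).deriv
  have hC1 : ContDiff ℝ 1 (DeBruijn.average (P.map X) (DeBruijn.heatKernel t)) :=
    contDiff_one_iff_deriv.2
      ⟨fun x => (DeBruijn.hasDerivAt_average_heatKernel (P.map X) ht x).differentiableAt,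
        hderiv ▸ DeBruijn.continuous_average_heatKernelDeriv (P.map X) ht⟩
  have hint := DeBruijn.integrable_sq_average_heatKernelDeriv_div hL ht
  have hfisher : DeBruijn.fisherInfo (P.map (fun ω => X ω + √t * Z ω)) =
      ENNReal.ofReal (∫ x, DeBruijn.average (P.map X) (DeBruijn.heatKernelDeriv t) x ^ 2 /
        DeBruijn.average (P.map X) (DeBruijn.heatKernel t) x) := by
    rw [DeBruijn.fisherInfo_eq (DeBruijn.isACDensity_of_contDiff hC1
      (fun x => (DeBruijn.average_heatKernel_pos hL ht x).le) (hlaw ht)), hderiv,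
      ofReal_integral_eq_lintegral_ofReal hint (ae_of_all _ fun x =>
        div_nonneg (sq_nonneg _) (DeBruijn.average_heatKernel_pos hL ht x).le)]
  refine ⟨?_, ?_, ?_, ?_⟩
  · rw [hent ht]
    exact EReal.coe_ne_bot _
  · rw [hent ht]
    exact EReal.coe_ne_top _
  · rw [hfisher]
    exact ENNReal.ofReal_ne_top
  · rw [hfisher, ENNReal.toReal_ofReal (integral_nonneg fun x =>
      div_nonneg (sq_nonneg _) (DeBruijn.average_heatKernel_pos hL ht x).le)]
    -- The integral formula for the entropy is available only for `s > 0`, which is a neighbourhood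
    -- of `t`.
    refine (DeBruijn.hasDerivAt_integral_neg_mul_log hL ht).congr_of_eventuallyEq ?_
    filter_upwards [Ioi_mem_nhds ht] with s hs
    rw [hent hs, EReal.toReal_coe]
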